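/- All graphs are finite and simple; $P_n$ and $C_n$ denote the path and the cycle with $n$ vertices, and $\Delta(G)$ is the maximum degree of $G$. The $k$-deck of a graph $G$ is the multiset of isomorphism classes of the subgraphs $G[S]$ induced by the $k$-element vertex subsets $S$ of $G$. A graph $G$ is $k$-deck reconstructible if every graph with the same $k$-deck as $G$ is isomorphic to $G$, and $\rho(G)$ is the least $k\ge 0$ such that $G$ is $k$-deck reconstructible. For a class $\mathcal C$ of graphs, say that the $k$-deck determines connectedness of $n$-vertex graphs in $\mathcal C$ if, whenever two $n$-vertex graphs in $\mathcal C$ have the same $k$-deck, either both are connected or both are disconnected. (a) For every $n\ge 3$, the least $k\ge 0$ such that the $k$-deck determines connectedness of $n$-vertex graphs exists and is at least $\lfloor n/2\rfloor+1$. The same bound holds for the least such $k$ when only graphs with $\Delta(G)\le 2$ are considered and, if $n\ge 4$, also when only graphs with $\Delta(G)=2$ are considered. (b) For every $n\ge 6$, $\rho(P_n)=\lfloor n/2\rfloor+1$ and $\rho(C_n)=\lfloor n/2\rfloor$. -/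

import Mathlib

namespace SimpleGraph

/-- Isomorphism of graphs on the vertex set `Fin k`. -/
def isoSetoid (k : ℕ) : Setoid (SimpleGraph (Fin k)) where
  r G H := Nonempty (G ≃g H)
  iseqv :=
    { refl := fun _ => ⟨RelIso.refl _⟩
      symm := fun ⟨e⟩ => ⟨e.symm⟩
      trans := fun ⟨e⟩ ⟨f⟩ => ⟨e.trans f⟩ }

/-- Unlabeled graphs with `k` vertices: isomorphism classes of graphs on `Fin k`. -/
abbrev Unlabeled (k : ℕ) : Type := Quotient (isoSetoid k)

/-- The `k`-card of `G` on a set `S` of `k` vertices: the isomorphism class of the subgraph of `G`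
induced by `S`. -/
noncomputable def kCard {V : Type*} (G : SimpleGraph V) {k : ℕ} (S : Finset V)
    (hS : S.card = k) : Unlabeled k :=
  Quotient.mk (isoSetoid k)
    ((G.induce (S : Set V)).overFin (n := k) (by simpa using hS))

/-- The `k`-deck of `G`: the multiset of all `k`-cards, one for each set of `k` vertices. -/
noncomputable def kDeck {V : Type*} [Fintype V] (k : ℕ) (G : SimpleGraph V) :
    Multiset (Unlabeled k) :=
  (Finset.univ : Finset {S : Finset V // S.card = k}).val.map fun S => G.kCard S.1 S.2

/-- `G` is `k`-deck reconstructible: every finite graph (with any number of vertices) that has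
the same `k`-deck as `G` is isomorphic to `G`. -/
def IsDeckReconstructible {V : Type*} [Fintype V] (k : ℕ) (G : SimpleGraph V) : Prop :=
  ∀ (m : ℕ) (H : SimpleGraph (Fin m)), H.kDeck k = G.kDeck k → Nonempty (H ≃g G)

/-- Among the `n`-vertex graphs in the class `C`, the `k`-deck determines whether the graph is
connected: no connected and disconnected graph in the class have the same `k`-deck. -/
def DeckDeterminesConnected (n : ℕ) (C : SimpleGraph (Fin n) → Prop) (k : ℕ) : Prop :=
  ∀ G H : SimpleGraph (Fin n), C G → C H → G.kDeck k = H.kDeck k → (G.Connected ↔ H.Connected)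

open Classical in
/-- The maximum degree of a finite graph. -/
noncomputable def maxDeg {V : Type*} [Fintype V] (G : SimpleGraph V) : ℕ :=
  G.maxDegree

end SimpleGraph

namespace SimpleGraph

variable {V W : Type*}

/-! ### Decks and counts of labelled copies -/

/-! The lower bounds come from pairs of graphs, one connected and one not, with equal decks. Cut the
positions `0, …, n - 1` at `a` and stack the two strands. If a vertex set misses a column,
exchanging the strands before its first empty column keeps the adjacencies inside the set, while the
edge from `a - 1` to `a` becomes the edge from `a - 1` to `0`. A path thus turns into a cycle plus a
path, and a cycle into two cycles. The exchange is an involution on `k`-sets, so the decks agree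
(`kDeck_eq_of_columnSwap`) as long as `k` is too small for a set to meet every column in a harmful
way.

The upper bounds rest on Kelly's lemma: the `k`-deck determines the number of copies of each graph
on at most `k` vertices. Copies of `P_2` and `P_3` give the sums of `d` and `d ^ 2` over the degrees
`d`. For a path, the sum of `(d - 1) * (d - 2)` vanishes, which forces degrees at most two. Short
cycles are excluded by Kelly's lemma, long ones because they would contain too many copies of `P_k`;
the edge count then leaves only a tree, hence a path. For a cycle, the sum of `(d - 2) ^ 2`
vanishes, so the graph is 2-regular; Kelly's lemma excludes cycles on at most half of the vertices,
and two disjoint longer ones do not fit. -/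

lemma kCard_eq_kCard_iff {G : SimpleGraph V} {H : SimpleGraph W} {k : ℕ} {S : Finset V}
    {T : Finset W} (hS : S.card = k) (hT : T.card = k) :
    G.kCard S hS = H.kCard T hT ↔
      Nonempty (G.induce (S : Set V) ≃g H.induce (T : Set W)) := by
  unfold kCard
  rw [Quotient.eq]
  constructor
  · rintro ⟨e⟩
    exact ⟨((overFinIso _ _).trans e).trans (overFinIso _ _).symm⟩
  · rintro ⟨e⟩
    exact ⟨((overFinIso _ _).symm.trans e).trans (overFinIso _ _)⟩

/-- Two graphs have the same `k`-deck as soon as their `k`-sets can be matched bijectively so that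
matched sets induce isomorphic graphs. -/
lemma kDeck_eq_of_equiv [Fintype V] [Fintype W] {G : SimpleGraph V} {H : SimpleGraph W} {k : ℕ}
    (e : {S : Finset V // S.card = k} ≃ {S : Finset W // S.card = k})
    (he : ∀ S, Nonempty (G.induce (S.1 : Set V) ≃g H.induce ((e S).1 : Set W))) :
    G.kDeck k = H.kDeck k := by
  unfold kDeck
  rw [← Finset.map_univ_equiv e, Finset.map_val, Multiset.map_map]
  refine Multiset.map_congr rfl fun S _ ↦ ?_
  exact (kCard_eq_kCard_iff S.2 (e S).2).2 (he S)

lemma card_kDeck [Fintype V] (G : SimpleGraph V) (k : ℕ) :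
    (G.kDeck k).card = (Fintype.card V).choose k := by
  simp [kDeck]

/-- The whole graph is its only card with `Fintype.card V` vertices. -/
lemma nonempty_iso_of_kDeck_card_eq [Fintype V] [Fintype W] {G : SimpleGraph V}
    {H : SimpleGraph W} {k : ℕ} (hV : Fintype.card V = k) (hW : Fintype.card W = k)
    (h : G.kDeck k = H.kDeck k) : Nonempty (G ≃g H) := by
  have hG : G.kCard Finset.univ hV ∈ G.kDeck k :=
    Multiset.mem_map.2 ⟨⟨Finset.univ, hV⟩, by simp, rfl⟩
  rw [h] at hG
  obtain ⟨⟨T, hT⟩, -, hc⟩ := Multiset.mem_map.1 hG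
  have hTu : T = Finset.univ := (Finset.card_eq_iff_eq_univ T).1 (hT.trans hW.symm)
  subst hTu
  obtain ⟨e⟩ := (kCard_eq_kCard_iff _ _).1 hc
  rw [Finset.coe_univ, Finset.coe_univ] at e
  exact ⟨((induceUnivIso G).symm.trans e.symm).trans (induceUnivIso H)⟩

/-- A nonempty `k`-deck with `0 < k` determines the number of vertices. -/
lemma card_eq_of_kDeck_eq [Fintype V] [Fintype W] {G : SimpleGraph V} {H : SimpleGraph W} {k : ℕ}
    (hk : 0 < k) (hkV : k ≤ Fintype.card V) (h : H.kDeck k = G.kDeck k) :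
    Fintype.card W = Fintype.card V := by
  -- The deck has `(Fintype.card V).choose k` cards, and by Pascal's rule this is strictly
  -- increasing in the relevant range.
  have key : ∀ {a b : ℕ}, a < b → k ≤ b → a.choose k < b.choose k := by
    intro a b hab hkb
    obtain ⟨c, rfl⟩ := Nat.exists_eq_succ_of_ne_zero (by omega : b ≠ 0)
    obtain ⟨j, rfl⟩ := Nat.exists_eq_succ_of_ne_zero hk.ne'
    have h₁ := Nat.choose_le_choose (j + 1) (by omega : a ≤ c)
    have h₂ := Nat.choose_pos (by omega : j ≤ c)
    rw [Nat.succ_eq_add_one, Nat.succ_eq_add_one, Nat.choose_succ_succ']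
    omega
  have hc := congrArg Multiset.card h
  rw [card_kDeck, card_kDeck] at hc
  rcases lt_trichotomy (Fintype.card W) (Fintype.card V) with hlt | heq | hgt
  · exact absurd hc (key hlt hkV).ne
  · exact heq
  · exact absurd hc (key hgt (by omega)).ne'

lemma labelledCopyCount_congr {U : Type*} [Fintype U] [Fintype V] [Fintype W] {G : SimpleGraph V}
    {H : SimpleGraph W} (e : G ≃g H) (F : SimpleGraph U) :
    G.labelledCopyCount F = H.labelledCopyCount F := by
  classical
  unfold labelledCopyCount
  refine Fintype.card_congr ⟨e.toCopy.comp, e.symm.toCopy.comp, fun f ↦ ?_, fun f ↦ ?_⟩ <;>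
  · ext a
    simp [Copy.comp_apply]

/-- Copies of `F` in the subgraph induced by `s` are the copies of `F` with image in `s`. -/
def copyInduceEquiv (G : SimpleGraph V) (F : SimpleGraph W) (s : Set V) :
    Copy F (G.induce s) ≃ {f : Copy F G // ∀ w, f w ∈ s} where
  toFun f := ⟨(Copy.induce G s).comp f, fun w ↦ (f w).2⟩
  invFun f := ⟨⟨fun w ↦ ⟨f.1 w, f.2 w⟩, fun h ↦ f.1.toHom.map_adj h⟩,
    fun _ _ h ↦ f.1.injective (congrArg Subtype.val h)⟩
  left_inv _ := rfl
  right_inv _ := rfl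

/-- Kelly's lemma: summing the number of labelled copies of `F` over all `k`-cards. -/
theorem sum_labelledCopyCount_induce [Fintype V] [Fintype W] (G : SimpleGraph V)
    (F : SimpleGraph W) {k : ℕ} (hk : Fintype.card W ≤ k) :
    ∑ S : {S : Finset V // S.card = k}, (G.induce (S.1 : Set V)).labelledCopyCount F =
      G.labelledCopyCount F *
        (Fintype.card V - Fintype.card W).choose (k - Fintype.card W) := by
  classical
  -- Double counting: a copy lies in a card exactly when its image does, and an image of
  -- `Fintype.card W` vertices lies in the same number of `k`-sets for every copy.
  have h₁ : ∀ S : {S : Finset V // S.card = k},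
      (G.induce (S.1 : Set V)).labelledCopyCount F =
        ∑ f : Copy F G, if Finset.univ.image f ⊆ S.1 then 1 else 0 := by
    intro S
    unfold labelledCopyCount
    rw [Finset.sum_boole, Nat.cast_id, ← Fintype.card_subtype]
    simp only [← Nat.card_eq_fintype_card]
    refine Nat.card_congr ((copyInduceEquiv G F S.1).trans
      (Equiv.subtypeEquivRight fun f ↦ ?_))
    simp [Finset.image_subset_iff]
  have h₂ : ∀ f : Copy F G, (∑ S : {S : Finset V // S.card = k},
      if Finset.univ.image f ⊆ S.1 then 1 else 0) =
        (Fintype.card V - Fintype.card W).choose (k - Fintype.card W) := by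
    intro f
    have hf : (Finset.univ.image f).card = Fintype.card W :=
      Finset.card_image_of_injective _ f.injective
    have := Finset.card_filter_powersetCard_subset (Finset.univ.image f) Finset.univ k
      (Finset.subset_univ _) (hf.trans_le hk)
    rw [hf, Finset.card_univ] at this
    rw [← this, Finset.card_filter]
    exact (Finset.sum_subtype _ (fun S ↦ by simp)
      (fun S ↦ if Finset.univ.image f ⊆ S then 1 else 0)).symm
  rw [Finset.sum_congr rfl fun S _ ↦ h₁ S, Finset.sum_comm, Finset.sum_congr rfl fun f _ ↦ h₂ f]
  simp [labelledCopyCount]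

lemma sum_map_kDeck [Fintype V] [Fintype W] (G : SimpleGraph V) (F : SimpleGraph W) {k : ℕ}
    {N : Unlabeled k → ℕ}
    (hN : ∀ K : SimpleGraph (Fin k), N (Quotient.mk (isoSetoid k) K) = K.labelledCopyCount F) :
    ((G.kDeck k).map N).sum =
      ∑ S : {S : Finset V // S.card = k}, (G.induce (S.1 : Set V)).labelledCopyCount F := by
  rw [kDeck, Multiset.map_map]
  refine Finset.sum_congr rfl fun S _ ↦ (hN _).trans ?_
  exact (labelledCopyCount_congr (overFinIso _ (by simpa using S.2)) F).symm

/-- The `k`-deck determines the number of labelled copies of every graph with at most `k`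
vertices. -/
theorem labelledCopyCount_eq_of_kDeck_eq {U : Type*} [Fintype U] [Fintype V] [Fintype W]
    {G : SimpleGraph V} {H : SimpleGraph W} {k : ℕ} (h : G.kDeck k = H.kDeck k)
    (hVW : Fintype.card V = Fintype.card W) (hkV : k ≤ Fintype.card V)
    (F : SimpleGraph U) (hF : Fintype.card U ≤ k) :
    G.labelledCopyCount F = H.labelledCopyCount F := by
  let N : Unlabeled k → ℕ := Quotient.lift (fun K ↦ K.labelledCopyCount F)
    fun _ _ ⟨e⟩ ↦ labelledCopyCount_congr e F
  have hs := congrArg (fun D ↦ (D.map N).sum) h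
  simp only [sum_map_kDeck _ F (N := N) fun _ ↦ rfl] at hs
  rw [sum_labelledCopyCount_induce G F hF, sum_labelledCopyCount_induce H F hF, ← hVW] at hs
  exact Nat.eq_of_mul_eq_mul_right (Nat.choose_pos (by omega)) hs

/-! ### Pairs of graphs with equal decks

A set of positions in `Fin n` is read as two strands `0, …, a - 1` and `a, …, n - 1`, with `j` and
`a + j` in column `j`. Exchanging the two strands before an empty column preserves induced
subgraphs while it reconnects the strands. -/

section ColumnSwap

variable {n : ℕ}

/-- Exchange `j` and `a + j` for all `j < i`. -/
def columnSwapFun (a i : ℕ) (v : Fin n) : Fin n :=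
  if h : v.1 < i ∧ v.1 + a < n then ⟨v.1 + a, h.2⟩
  else if a ≤ v.1 ∧ v.1 < a + i then ⟨v.1 - a, by omega⟩ else v

lemma val_columnSwapFun (a i : ℕ) (v : Fin n) :
    (columnSwapFun a i v).1 = if v.1 < i ∧ v.1 + a < n then v.1 + a
      else if a ≤ v.1 ∧ v.1 < a + i then v.1 - a else v.1 := by
  unfold columnSwapFun
  split_ifs <;> rfl

lemma columnSwapFun_involutive {a i : ℕ} (hi : i ≤ a) :
    Function.Involutive (columnSwapFun (n := n) a i) := by
  intro v
  ext
  rw [val_columnSwapFun, val_columnSwapFun]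
  split_ifs <;> omega

/-- No element of `S` lies in column `j`. -/
def ColumnEmpty (a : ℕ) (S : Finset (Fin n)) (j : ℕ) : Prop :=
  ∀ v ∈ S, v.1 ≠ j ∧ v.1 ≠ a + j

/-- The first empty column among the first `r` columns, or `0` if there is none. -/
noncomputable def firstEmptyColumn (a r : ℕ) (S : Finset (Fin n)) : ℕ :=
  sInf {i | i < r ∧ ColumnEmpty a S i}

lemma firstEmptyColumn_le (a r : ℕ) (S : Finset (Fin n)) : firstEmptyColumn a r S ≤ r := by
  rcases Set.eq_empty_or_nonempty {i | i < r ∧ ColumnEmpty a S i} with h | h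
  · simp [firstEmptyColumn, h]
  · exact (Nat.sInf_mem h).1.le

lemma firstEmptyColumn_spec {a r : ℕ} {S : Finset (Fin n)}
    (h : ∃ i < r, ColumnEmpty a S i) :
    firstEmptyColumn a r S < r ∧ ColumnEmpty a S (firstEmptyColumn a r S) :=
  Nat.sInf_mem (s := {i | i < r ∧ ColumnEmpty a S i}) h

lemma firstEmptyColumn_eq_zero {a r : ℕ} {S : Finset (Fin n)}
    (h : ¬ ∃ i < r, ColumnEmpty a S i) : firstEmptyColumn a r S = 0 := by
  have : {i | i < r ∧ ColumnEmpty a S i} = ∅ := Set.eq_empty_of_forall_notMem fun i hi ↦ h ⟨i, hi⟩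
  simp [firstEmptyColumn, this]

lemma ColumnEmpty.image {a r i j : ℕ} (hr : r ≤ a) (hi : i < r) (hj : j < r)
    {S : Finset (Fin n)} (h : ColumnEmpty a S j) :
    ColumnEmpty a (S.image (columnSwapFun a i)) j := by
  intro w hw
  obtain ⟨v, hv, rfl⟩ := Finset.mem_image.1 hw
  have := h v hv
  have := v.2
  rw [val_columnSwapFun]
  split_ifs <;> omega

lemma image_columnSwapFun_zero (a : ℕ) (S : Finset (Fin n)) :
    S.image (columnSwapFun a 0) = S := by
  have : columnSwapFun (n := n) a 0 = id := by
    funext v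
    ext
    rw [val_columnSwapFun]
    split_ifs <;> simp <;> omega
  rw [this, Finset.image_id]

/-- Exchange the two strands of `S` before its first empty column. -/
noncomputable def columnSwap (a r : ℕ) (S : Finset (Fin n)) : Finset (Fin n) :=
  S.image (columnSwapFun a (firstEmptyColumn a r S))

/-- The exchange moves elements only within their columns, so it does not change which columns are
empty. This makes `columnSwap` undo itself. -/
lemma firstEmptyColumn_columnSwap {a r : ℕ} (hr : r ≤ a) (S : Finset (Fin n)) : firstEmptyColumn a r (columnSwap a r S) = firstEmptyColumn a r S := by
  by_cases h : ∃ i < r, ColumnEmpty a S i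
  · have hlt := (firstEmptyColumn_spec h).1
    have hset : {i | i < r ∧ ColumnEmpty a (columnSwap a r S) i} =
        {i | i < r ∧ ColumnEmpty a S i} := by
      ext j
      refine and_congr_right fun hj ↦ ⟨fun hS ↦ ?_, fun hS ↦ hS.image hr hlt hj⟩
      have := hS.image hr hlt hj
      rwa [columnSwap, Finset.image_image,
        (columnSwapFun_involutive (hlt.le.trans hr)).comp_self, Finset.image_id] at this
    rw [firstEmptyColumn, hset, firstEmptyColumn]
  · have h0 := firstEmptyColumn_eq_zero h
    rw [columnSwap, h0, image_columnSwapFun_zero, h0]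

lemma columnSwap_involutive {a r : ℕ} (hr : r ≤ a) :
    Function.Involutive (columnSwap (n := n) a r) := by
  intro S
  rw [columnSwap, firstEmptyColumn_columnSwap hr, columnSwap, Finset.image_image,
    (columnSwapFun_involutive ((firstEmptyColumn_le a r S).trans hr)).comp_self, Finset.image_id]

lemma card_columnSwap {a r : ℕ} (hr : r ≤ a) (S : Finset (Fin n)) :
    (columnSwap a r S).card = S.card :=
  Finset.card_image_of_injective _
    (columnSwapFun_involutive ((firstEmptyColumn_le a r S).trans hr)).injective

/-- If exchanging strands before the first empty column turns edges of `G` into edges of `H` on all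
`k`-sets, then the two graphs have the same `k`-deck. -/
theorem kDeck_eq_of_columnSwap {G H : SimpleGraph (Fin n)} {a r k : ℕ} (hr : r ≤ a)
    (h : ∀ S : Finset (Fin n), S.card = k → ∀ u ∈ S, ∀ v ∈ S,
      (H.Adj (columnSwapFun a (firstEmptyColumn a r S) u)
        (columnSwapFun a (firstEmptyColumn a r S) v) ↔ G.Adj u v)) :
    G.kDeck k = H.kDeck k := by
  refine kDeck_eq_of_equiv ((columnSwap_involutive hr).toPerm.subtypeEquiv fun S ↦ ?_)
    fun S ↦ ⟨?_⟩
  · rw [Function.Involutive.coe_toPerm, card_columnSwap hr]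
  · have hinv := columnSwapFun_involutive (n := n) ((firstEmptyColumn_le a r S.1).trans hr)
    refine ⟨hinv.toPerm.subtypeEquiv fun v ↦ ?_, ?_⟩
    · exact (hinv.injective.mem_finset_image).symm
    · intro u v
      exact h S.1 S.2 u u.2 v v.2

/-- A set without empty columns is large. -/
lemma le_card_of_not_columnEmpty {a r : ℕ} (hr : r ≤ a) {S : Finset (Fin n)}
    (h : ¬ ∃ i < r, ColumnEmpty a S i) :
    r ≤ S.card ∧ ∀ w ∈ S, r ≤ w.1 → w.1 < a → r + 1 ≤ S.card := by
  -- The function sends a position to its column, so `S` has at least as many elements as occupied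
  -- columns.
  have hsub : Finset.range r ⊆ S.image fun v ↦ if v.1 < a then v.1 else v.1 - a := by
    intro i hi
    rw [Finset.mem_range] at hi
    by_contra hc
    refine h ⟨i, hi, fun v hv ↦ ?_⟩
    by_contra hvi
    refine hc (Finset.mem_image.2 ⟨v, hv, ?_⟩)
    split_ifs <;> omega
  refine ⟨?_, fun w hw hrw hwa ↦ ?_⟩
  · simpa using (Finset.card_le_card hsub).trans Finset.card_image_le
  · have hins : insert w.1 (Finset.range r) ⊆ S.image fun v ↦ if v.1 < a then v.1 else v.1 - a :=
      Finset.insert_subset (Finset.mem_image.2 ⟨w, hw, by simp [hwa]⟩) hsub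
    have := (Finset.card_le_card hins).trans Finset.card_image_le
    rwa [Finset.card_insert_of_notMem (by simpa using hrw), Finset.card_range] at this

end ColumnSwap

/-- The disjoint union of a cycle on `0, …, a - 1` and a path on `a, …, n - 1`. -/
def cycleAddPath (a n : ℕ) : SimpleGraph (Fin n) where
  Adj u v := u ≠ v ∧ ((u.1 + 1 = v.1 ∧ v.1 ≠ a) ∨ (v.1 + 1 = u.1 ∧ u.1 ≠ a) ∨
    (u.1 = 0 ∧ v.1 + 1 = a) ∨ (v.1 = 0 ∧ u.1 + 1 = a))
  symm := ⟨fun u v h ↦ ⟨h.1.symm, by have := h.2; omega⟩⟩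
  loopless := ⟨fun u h ↦ h.1 rfl⟩

/-- The disjoint union of a cycle on `0, …, a - 1` and a cycle on `a, …, n - 1`. -/
def cycleAddCycle (a n : ℕ) : SimpleGraph (Fin n) where
  Adj u v := u ≠ v ∧ ((u.1 + 1 = v.1 ∧ v.1 ≠ a) ∨ (v.1 + 1 = u.1 ∧ u.1 ≠ a) ∨
    (u.1 = 0 ∧ v.1 + 1 = a) ∨ (v.1 = 0 ∧ u.1 + 1 = a) ∨
    (u.1 = a ∧ v.1 + 1 = n) ∨ (v.1 = a ∧ u.1 + 1 = n))
  symm := ⟨fun u v h ↦ ⟨h.1.symm, by have := h.2; omega⟩⟩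
  loopless := ⟨fun u h ↦ h.1 rfl⟩

lemma cycleAddPath_adj {a n : ℕ} {u v : Fin n} : (cycleAddPath a n).Adj u v ↔
    u.1 ≠ v.1 ∧ ((u.1 + 1 = v.1 ∧ v.1 ≠ a) ∨ (v.1 + 1 = u.1 ∧ u.1 ≠ a) ∨
      (u.1 = 0 ∧ v.1 + 1 = a) ∨ (v.1 = 0 ∧ u.1 + 1 = a)) :=
  and_congr_left' (not_congr Fin.ext_iff)

lemma cycleAddCycle_adj {a n : ℕ} {u v : Fin n} : (cycleAddCycle a n).Adj u v ↔
    u.1 ≠ v.1 ∧ ((u.1 + 1 = v.1 ∧ v.1 ≠ a) ∨ (v.1 + 1 = u.1 ∧ u.1 ≠ a) ∨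
      (u.1 = 0 ∧ v.1 + 1 = a) ∨ (v.1 = 0 ∧ u.1 + 1 = a) ∨
      (u.1 = a ∧ v.1 + 1 = n) ∨ (v.1 = a ∧ u.1 + 1 = n)) :=
  and_congr_left' (not_congr Fin.ext_iff)

lemma cycleGraph_adj_iff_val {n : ℕ} (hn : 2 ≤ n) {u v : Fin n} : (cycleGraph n).Adj u v ↔
    u.1 + 1 = v.1 ∨ v.1 + 1 = u.1 ∨ (u.1 = 0 ∧ v.1 + 1 = n) ∨ (v.1 = 0 ∧ u.1 + 1 = n) := by
  rw [cycleGraph_adj']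
  have hu := u.2
  have hv := v.2
  rcases lt_trichotomy u v with h | h | h
  · rw [Fin.coe_sub_iff_lt.2 h, Fin.coe_sub_iff_le.2 h.le]
    rw [Fin.lt_def] at h
    omega
  · subst h
    rw [Fin.coe_sub_iff_le.2 le_rfl]
    omega
  · rw [Fin.coe_sub_iff_lt.2 h, Fin.coe_sub_iff_le.2 h.le]
    rw [Fin.lt_def] at h
    omega

/-- The graphs differ only in one edge at `a - 1`, which ends at `a` or at `0`. A nontrivial
exchange swaps these two ends; if column `0` is empty, the set contains neither. The last column
used, `n - a`, holds a single position, which gains one in the bound on `k`. -/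
theorem kDeck_pathGraph_eq_kDeck_cycleAddPath {a n k : ℕ} (han : a ≤ n) (hna : n + 2 ≤ 2 * a)
    (hk : a + k ≤ n + 1) : (pathGraph n).kDeck k = (cycleAddPath a n).kDeck k := by
  refine kDeck_eq_of_columnSwap (a := a) (r := n - a + 1) (by omega) ?_
  intro S hS u hu v hv
  have hu' := u.2
  have hv' := v.2
  rw [cycleAddPath_adj, pathGraph_adj, val_columnSwapFun, val_columnSwapFun]
  by_cases h : ∃ i < n - a + 1, ColumnEmpty a S i
  · obtain ⟨hlt, hemp⟩ := firstEmptyColumn_spec h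
    have h₁ := hemp u hu
    have h₂ := hemp v hv
    generalize firstEmptyColumn a (n - a + 1) S = i at *
    split_ifs <;> omega
  -- Now `S` has exactly one element per column below `r`, so it misses `a - 1` and neither
  -- differing edge is seen; the identity works.
  · have hlast := (le_card_of_not_columnEmpty (by omega) h).2
    have h₁ := hlast u hu
    have h₂ := hlast v hv
    rw [firstEmptyColumn_eq_zero h]
    split_ifs <;> omega

/-- Swapping `0` and `a` exchanges the ends of the edges at both `a - 1` and `n - 1`. Since `k` is
less than the number of columns, an empty column always exists. -/
theorem kDeck_cycleGraph_eq_kDeck_cycleAddCycle {a n k : ℕ} (hna : n ≤ 2 * a)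
    (hk : a + k < n) (hn : 2 ≤ n) : (cycleGraph n).kDeck k = (cycleAddCycle a n).kDeck k := by
  refine kDeck_eq_of_columnSwap (a := a) (r := n - a) (by omega) ?_
  intro S hS u hu v hv
  have hu' := u.2
  have hv' := v.2
  have h : ∃ i < n - a, ColumnEmpty a S i := by
    by_contra h
    have := (le_card_of_not_columnEmpty (by omega) h).1
    omega
  obtain ⟨hlt, hemp⟩ := firstEmptyColumn_spec h
  have h₁ := hemp u hu
  have h₂ := hemp v hv
  rw [cycleAddCycle_adj, cycleGraph_adj_iff_val hn, val_columnSwapFun, val_columnSwapFun]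
  generalize firstEmptyColumn a (n - a) S = i at *
  split_ifs <;> omega

/-! ### Connectedness and maximum degree of the examples; lower bounds -/

lemma not_connected_of_closed {V : Type*} {G : SimpleGraph V} {s : Set V}
    (hs : ∀ u v, G.Adj u v → u ∈ s → v ∈ s) {x y : V} (hx : x ∈ s) (hy : y ∉ s) :
    ¬ G.Connected := by
  intro hG
  obtain ⟨p⟩ := hG.preconnected x y
  induction p with
  | nil => exact hy hx
  | cons h p ih => exact ih (hs _ _ h hx) hy

lemma not_connected_cycleAddPath {a n : ℕ} (ha : 0 < a) (han : a < n) :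
    ¬ (cycleAddPath a n).Connected := by
  refine not_connected_of_closed (s := {v | v.1 < a}) (x := ⟨0, by omega⟩) (y := ⟨a, han⟩)
    (fun u v h hu ↦ ?_) ha (lt_irrefl a)
  rw [cycleAddPath_adj] at h
  simp only [Set.mem_ofPred_eq] at hu ⊢
  omega

lemma not_connected_cycleAddCycle {a n : ℕ} (ha : 0 < a) (han : a < n) :
    ¬ (cycleAddCycle a n).Connected := by
  refine not_connected_of_closed (s := {v | v.1 < a}) (x := ⟨0, by omega⟩) (y := ⟨a, han⟩)
    (fun u v h hu ↦ ?_) ha (lt_irrefl a)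
  rw [cycleAddCycle_adj] at h
  simp only [Set.mem_ofPred_eq] at hu ⊢
  omega

lemma connected_pathGraph {n : ℕ} (hn : 0 < n) : (pathGraph n).Connected := by
  obtain ⟨m, rfl⟩ := Nat.exists_eq_succ_of_ne_zero hn.ne'
  exact pathGraph_connected m

lemma connected_cycleGraph {n : ℕ} (hn : 0 < n) : (cycleGraph n).Connected :=
  (connected_pathGraph hn).mono pathGraph_le_cycleGraph

lemma degree_le_two_of_forall {V : Type*} {G : SimpleGraph V} {v : V}
    [Fintype (G.neighborSet v)]
    (h : ∀ a b c, G.Adj v a → G.Adj v b → G.Adj v c → a = b ∨ a = c ∨ b = c) :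
    G.degree v ≤ 2 := by
  by_contra! hd
  obtain ⟨a, b, c, ha, hb, hc, hab, hac, hbc⟩ := Finset.two_lt_card_iff.1 hd
  rw [mem_neighborFinset] at ha hb hc
  have := h a b c ha hb hc
  tauto

lemma maxDeg_eq_two {V : Type*} [Fintype V] {G : SimpleGraph V}
    (h : ∀ v a b c, G.Adj v a → G.Adj v b → G.Adj v c → a = b ∨ a = c ∨ b = c)
    {v a b : V} (ha : G.Adj v a) (hb : G.Adj v b) (hab : a ≠ b) : G.maxDeg = 2 := by
  classical
  unfold maxDeg
  refine le_antisymm (maxDegree_le_of_forall_degree_le _ _ fun v ↦ degree_le_two_of_forall (h v)) ?_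
  refine le_trans ?_ (degree_le_maxDegree _ v)
  exact Finset.one_lt_card.2 ⟨a, by simpa using ha, b, by simpa using hb, hab⟩

lemma maxDeg_pathGraph {n : ℕ} (hn : 3 ≤ n) : (pathGraph n).maxDeg = 2 := by
  refine maxDeg_eq_two (v := ⟨1, by omega⟩) (a := ⟨0, by omega⟩) (b := ⟨2, by omega⟩) ?_
    (by simp [pathGraph_adj]) (by simp [pathGraph_adj]) (by simp)
  simp only [pathGraph_adj, Fin.ext_iff]
  omega

lemma maxDeg_cycleAddPath {a n : ℕ} (ha : 3 ≤ a) (han : a ≤ n) :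
    (cycleAddPath a n).maxDeg = 2 := by
  refine maxDeg_eq_two (v := ⟨1, by omega⟩) (a := ⟨0, by omega⟩) (b := ⟨2, by omega⟩) ?_
    (by rw [cycleAddPath_adj]; dsimp only; omega) (by rw [cycleAddPath_adj]; dsimp only; omega) (by simp)
  simp only [cycleAddPath_adj, Fin.ext_iff]
  omega

/-- Decks too small to determine connectedness, even among graphs of maximum degree two. -/
theorem not_deckDeterminesConnected {n k : ℕ} {C : SimpleGraph (Fin n) → Prop} (hn : 4 ≤ n)
    (hk : k ≤ n / 2) (hC : ∀ G, G.maxDeg = 2 → C G) : ¬ DeckDeterminesConnected n C k := by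
  intro h
  -- This is the least `a` with `n + 2 ≤ 2 * a`; it allows `k` up to `n + 1 - a = n / 2`.
  have := h (pathGraph n) (cycleAddPath ((n + 1) / 2 + 1) n) (hC _ (maxDeg_pathGraph (by omega)))
    (hC _ (maxDeg_cycleAddPath (by omega) (by omega)))
    (kDeck_pathGraph_eq_kDeck_cycleAddPath (by omega) (by omega) (by omega))
  exact not_connected_cycleAddPath (by omega) (by omega)
    (this.1 (connected_pathGraph (by omega)))

/-- For `n = 3` the cycle would use all vertices. Instead, cards with at most one vertex cannot tell
`P_3` from the empty graph. -/
theorem not_deckDeterminesConnected_three {k : ℕ} {C : SimpleGraph (Fin 3) → Prop}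
    (hk : k ≤ 1) (hC : ∀ G, G.maxDeg ≤ 2 → C G) : ¬ DeckDeterminesConnected 3 C k := by
  intro h
  have hmax : ∀ G : SimpleGraph (Fin 3), G.maxDeg ≤ 2 := by
    intro G
    classical
    have := G.maxDegree_lt_card_verts
    simp only [Fintype.card_fin] at this
    unfold maxDeg
    convert Nat.le_of_lt_succ this
  have hd : (pathGraph 3).kDeck k = (⊥ : SimpleGraph (Fin 3)).kDeck k := by
    refine kDeck_eq_of_equiv (Equiv.refl _) fun S ↦ ?_
    have hS : ∀ u ∈ S.1, ∀ v ∈ S.1, u = v := fun u hu v hv ↦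
      Finset.card_le_one.1 (S.2.trans_le hk) u hu v hv
    refine ⟨⟨Equiv.refl _, ?_⟩⟩
    intro u v
    have := hS u u.2 v v.2
    simp [this]
  have := h (pathGraph 3) ⊥ (hC _ (hmax _)) (hC _ (hmax _)) hd
  exact not_connected_of_closed (G := (⊥ : SimpleGraph (Fin 3))) (s := {0}) (x := 0) (y := 1)
    (fun u v h ↦ absurd h (by simp)) (by simp) (by simp)
    (this.1 (connected_pathGraph (by omega)))

lemma deckDeterminesConnected_self (n : ℕ) (C : SimpleGraph (Fin n) → Prop) :
    DeckDeterminesConnected n C n := by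
  intro G H _ _ h
  obtain ⟨e⟩ := nonempty_iso_of_kDeck_card_eq (Fintype.card_fin n) (Fintype.card_fin n) h
  exact e.connected_iff

lemma exists_isLeast_deckDeterminesConnected {n b : ℕ} {C : SimpleGraph (Fin n) → Prop}
    (h : ∀ k < b, ¬ DeckDeterminesConnected n C k) :
    ∃ k, IsLeast {j | DeckDeterminesConnected n C j} k ∧ b ≤ k := by
  have hne : {j | DeckDeterminesConnected n C j}.Nonempty := ⟨n, deckDeterminesConnected_self n C⟩
  refine ⟨sInf _, ⟨Nat.sInf_mem hne, fun j hj ↦ Nat.sInf_le hj⟩, ?_⟩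
  by_contra! hlt
  exact h _ hlt (Nat.sInf_mem hne)

theorem not_isDeckReconstructible_pathGraph {n k : ℕ} (hn : 4 ≤ n) (hk : k ≤ n / 2) :
    ¬ IsDeckReconstructible k (pathGraph n) := by
  intro h
  obtain ⟨e⟩ := h n (cycleAddPath ((n + 1) / 2 + 1) n)
    (kDeck_pathGraph_eq_kDeck_cycleAddPath (by omega) (by omega) (by omega)).symm
  exact not_connected_cycleAddPath (by omega) (by omega)
    (e.connected_iff.2 (connected_pathGraph (by omega)))

theorem not_isDeckReconstructible_cycleGraph {n k : ℕ} (hn : 2 ≤ n) (hk : k < n / 2) :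
    ¬ IsDeckReconstructible k (cycleGraph n) := by
  intro h
  -- This choice of `a` leaves `n - a = n / 2` columns, more than `k`.
  obtain ⟨e⟩ := h n (cycleAddCycle ((n + 1) / 2) n)
    (kDeck_cycleGraph_eq_kDeck_cycleAddCycle (by omega) (by omega) hn).symm
  exact not_connected_cycleAddCycle (by omega) (by omega)
    (e.connected_iff.2 (connected_cycleGraph (by omega)))

/-! ### Recognizing paths and cycles -/

section Recognition

variable {V W : Type*}

/-- A labelled copy with the right numbers of vertices and edges is an isomorphism. -/
lemma Copy.nonempty_iso_of_card_eq [Fintype V] [Fintype W] {A : SimpleGraph V}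
    {B : SimpleGraph W} [Fintype A.edgeSet] [Fintype B.edgeSet] (f : Copy A B)
    (hV : Fintype.card V = Fintype.card W) (hE : A.edgeFinset.card = B.edgeFinset.card) :
    Nonempty (A ≃g B) := by
  have hb : Function.Bijective f :=
    (Fintype.bijective_iff_injective_and_card f).2 ⟨f.injective, hV⟩
  refine ⟨⟨Equiv.ofBijective f hb, ?_⟩⟩
  intro a b
  refine ⟨fun h ↦ ?_, fun h ↦ f.toHom.map_adj h⟩
  have hs : Function.Bijective f.mapEdgeSet := by
    refine (Fintype.bijective_iff_injective_and_card _).2 ⟨f.mapEdgeSet.injective, ?_⟩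
    rwa [← edgeFinset_card, ← edgeFinset_card]
  obtain ⟨⟨e, he⟩, hfe⟩ := hs.2 ⟨s(f a, f b), h⟩
  have h₁ : Sym2.map f e = Sym2.map f s(a, b) := congrArg Subtype.val hfe
  have h₂ : e = s(a, b) := Sym2.map.injective f.injective h₁
  rw [h₂] at he
  exact he

/-- The copy injects the neighbors of `a` into those of `f a`, and the degrees leave no room for
others. Hence a cycle copied into a 2-regular graph has an image closed under adjacency. -/
lemma Copy.exists_adj_of_degree_le {A : SimpleGraph V} {B : SimpleGraph W} (f : Copy A B) {a : V}
    [Fintype (A.neighborSet a)] [Fintype (B.neighborSet (f a))]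
    (hd : B.degree (f a) ≤ A.degree a) {w : W} (hw : B.Adj (f a) w) :
    ∃ b, A.Adj a b ∧ f b = w := by
  classical
  have hsub : (A.neighborFinset a).image f ⊆ B.neighborFinset (f a) := by
    intro x hx
    obtain ⟨b, hb, rfl⟩ := Finset.mem_image.1 hx
    rw [mem_neighborFinset] at hb ⊢
    exact f.toHom.map_adj hb
  have heq := Finset.eq_of_subset_of_card_le hsub
    ((Finset.card_image_of_injective (f := f) _ f.injective).symm ▸ hd)
  have hw' : w ∈ (A.neighborFinset a).image f := by
    rw [heq, mem_neighborFinset]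
    exact hw
  obtain ⟨b, hb, rfl⟩ := Finset.mem_image.1 hw'
  exact ⟨b, (mem_neighborFinset _ _ _).1 hb, rfl⟩

lemma cycleGraph_exists_adj_ne {n : ℕ} (hn : 3 ≤ n) (i : Fin n) :
    ∃ x y, x ≠ y ∧ (cycleGraph n).Adj i x ∧ (cycleGraph n).Adj i y := by
  have hi := i.2
  refine ⟨⟨if i.1 + 1 < n then i.1 + 1 else 0, by split_ifs <;> omega⟩,
    ⟨if 0 < i.1 then i.1 - 1 else n - 1, by split_ifs <;> omega⟩, ?_, ?_, ?_⟩
  · rw [Ne, Fin.mk.injEq]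
    split_ifs <;> omega
  · rw [cycleGraph_adj_iff_val (by omega)]
    dsimp only
    split_ifs <;> omega
  · rw [cycleGraph_adj_iff_val (by omega)]
    dsimp only
    split_ifs <;> omega

lemma degree_cycleGraph {n : ℕ} (hn : 3 ≤ n) (i : Fin n)
    [Fintype ((cycleGraph n).neighborSet i)] : (cycleGraph n).degree i = 2 := by
  refine le_antisymm (degree_le_two_of_forall fun a b c ha hb hc ↦ ?_) ?_
  · rw [cycleGraph_adj_iff_val (by omega)] at ha hb hc
    simp only [Fin.ext_iff]
    omega
  · obtain ⟨x, y, hxy, hx, hy⟩ := cycleGraph_exists_adj_ne hn i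
    exact Finset.one_lt_card.2 ⟨x, by simpa using hx, y, by simpa using hy, hxy⟩

lemma degree_pathGraph_le_two {n : ℕ} (i : Fin n) [Fintype ((pathGraph n).neighborSet i)] :
    (pathGraph n).degree i ≤ 2 := by
  refine degree_le_two_of_forall fun a b c ha hb hc ↦ ?_
  simp only [pathGraph_adj] at ha hb hc
  simp only [Fin.ext_iff]
  omega

lemma degree_pathGraph_pos {n : ℕ} (hn : 2 ≤ n) (i : Fin n)
    [Fintype ((pathGraph n).neighborSet i)] : 0 < (pathGraph n).degree i := by
  rw [degree_pos_iff_exists_adj]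
  have hi := i.2
  refine ⟨⟨if i.1 + 1 < n then i.1 + 1 else i.1 - 1, by split_ifs <;> omega⟩, ?_⟩
  rw [pathGraph_adj]
  dsimp only
  split_ifs <;> omega

lemma isAcyclic_pathGraph (n : ℕ) : (pathGraph n).IsAcyclic := by
  rw [isAcyclic_iff_free_cycleGraph]
  rintro c hc ⟨f⟩
  have : Nonempty (Fin c) := ⟨⟨0, by omega⟩⟩
  -- The cycle vertex at the largest position has two distinct neighbors, yet both must sit one
  -- position lower.
  obtain ⟨i, -, hi⟩ := Finset.exists_max_image Finset.univ (fun j ↦ (f j).1) Finset.univ_nonempty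
  obtain ⟨x, y, hxy, hx, hy⟩ := cycleGraph_exists_adj_ne hc i
  have h₁ := pathGraph_adj.1 (f.toHom.map_adj hx)
  have h₂ := pathGraph_adj.1 (f.toHom.map_adj hy)
  have h₃ := hi x (Finset.mem_univ _)
  have h₄ := hi y (Finset.mem_univ _)
  simp only [Copy.toHom_apply] at h₁ h₂
  exact hxy (f.injective (Fin.ext (by simp only [Copy.toHom_apply]; omega)))

lemma isTree_pathGraph {n : ℕ} (hn : 0 < n) : (pathGraph n).IsTree :=
  ⟨connected_pathGraph hn, isAcyclic_pathGraph n⟩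

/-- An acyclic graph extends to a spanning tree of the complete graph. -/
lemma IsAcyclic.card_edgeFinset_lt [Fintype V] [Nonempty V] {G : SimpleGraph V}
    [Fintype G.edgeSet] (hG : G.IsAcyclic) : G.edgeFinset.card < Fintype.card V := by
  classical
  obtain ⟨T, hle, -, hT⟩ :=
    (connected_top (V := V)).exists_isTree_le_of_le_of_isAcyclic le_top hG
  have h₁ := hT.card_edgeFinset
  have h₂ := Finset.card_le_card (edgeFinset_mono hle)
  omega

lemma IsAcyclic.isTree_of_card_edgeFinset [Fintype V] [Nonempty V] {G : SimpleGraph V}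
    [Fintype G.edgeSet] (hG : G.IsAcyclic) (h : G.edgeFinset.card + 1 = Fintype.card V) :
    G.IsTree := by
  classical
  obtain ⟨T, hle, -, hT⟩ :=
    (connected_top (V := V)).exists_isTree_le_of_le_of_isAcyclic le_top hG
  have h₁ := hT.card_edgeFinset
  have h₂ := Finset.eq_of_subset_of_card_le (edgeFinset_mono hle) (by omega)
  rwa [edgeFinset_inj.1 h₂]

/-- A graph in which all degrees are two contains a cycle. -/
lemma exists_copy_cycleGraph_of_degree_eq_two [Fintype V] [Nonempty V] {G : SimpleGraph V}
    [DecidableRel G.Adj] (h : ∀ v, G.degree v = 2) : ∃ c ≥ 3, cycleGraph c ⊑ G := by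
  by_contra hc
  have hG : G.IsAcyclic := isAcyclic_iff_free_cycleGraph.2 fun c hc3 hf ↦ hc ⟨c, hc3, hf⟩
  have h₁ := hG.card_edgeFinset_lt
  have h₂ := G.sum_degrees_eq_twice_card_edges
  simp only [h, Finset.sum_const, Finset.card_univ, smul_eq_mul] at h₂
  omega

/-- A tree whose degrees are at most two is a path. -/
lemma IsTree.nonempty_iso_pathGraph [Fintype V] {G : SimpleGraph V} [DecidableRel G.Adj]
    (hG : G.IsTree) (hd : ∀ v, G.degree v ≤ 2) :
    Nonempty (G ≃g pathGraph (Fintype.card V)) := by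
  classical
  have : Nonempty V := hG.connected.nonempty
  obtain ⟨u, v, p, hp, hmax⟩ := Walk.exists_isPath_forall_isPath_length_le_length G
  -- A neighbor off the longest path would extend it at an end, or be a third neighbor of an inner
  -- vertex.
  have hclosed : ∀ x y, G.Adj x y → x ∈ {x | x ∈ p.support} → y ∈ {x | x ∈ p.support} := by
    intro x y hxy hx
    by_contra hy
    obtain ⟨i, rfl, hi⟩ := Walk.mem_support_iff_exists_getVert.1 hx
    rcases Nat.eq_zero_or_pos i with rfl | hi0
    · rw [Walk.getVert_zero] at hxy
      have := hmax _ _ _ (hp.cons (h := hxy.symm) hy)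
      rw [Walk.length_cons] at this
      omega
    rcases hi.eq_or_lt with rfl | hlt
    · rw [Walk.getVert_length] at hxy
      have := hmax _ _ _ (hp.concat hy hxy)
      rw [Walk.length_concat] at this
      omega
    have h₁ : G.Adj (p.getVert i) (p.getVert (i + 1)) := p.adj_getVert_succ hlt
    have h₂ : G.Adj (p.getVert i) (p.getVert (i - 1)) := by
      have := p.adj_getVert_succ (i := i - 1) (by omega)
      rw [Nat.sub_add_cancel hi0] at this
      exact this.symm
    have hne : p.getVert (i + 1) ≠ p.getVert (i - 1) := by
      intro h
      have := hp.getVert_injOn (show i + 1 ≤ p.length by omega)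
        (show i - 1 ≤ p.length by omega) h
      omega
    have hy' : ∀ j, p.getVert j ≠ y := fun j h ↦ hy (h ▸ p.getVert_mem_support j)
    have hcard : 2 < G.degree (p.getVert i) :=
      Finset.two_lt_card.2 ⟨_, (mem_neighborFinset _ _ _).2 h₁, _, (mem_neighborFinset _ _ _).2 h₂,
        _, (mem_neighborFinset _ _ _).2 hxy, hne, hy' _, hy' _⟩
    exact hcard.not_ge (hd _)
  have hall : ∀ y, y ∈ p.support := by
    intro y
    by_contra hy
    exact not_connected_of_closed hclosed p.start_mem_support hy hG.connected
  have hlen : p.length + 1 = Fintype.card V := by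
    have := (hp.isHamiltonian_iff.2 hall).length_support
    rwa [Walk.length_support] at this
  have f := hp.pathGraphCopy
  rw [hlen] at f
  obtain ⟨e⟩ := f.nonempty_iso_of_card_eq (by simp) (by
    have h₁ := hG.card_edgeFinset
    have h₂ := (isTree_pathGraph (n := Fintype.card V) Fintype.card_pos).card_edgeFinset
    rw [Fintype.card_fin] at h₂
    omega)
  exact ⟨e.symm⟩

/-- If all degrees are two and every cycle has more than half of the vertices, then the graph is a
cycle. -/
lemma nonempty_iso_cycleGraph_of_degree_eq_two [Fintype V] [Nonempty V] {G : SimpleGraph V}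
    [DecidableRel G.Adj] (hd : ∀ v, G.degree v = 2)
    (hc : ∀ c ≥ 3, cycleGraph c ⊑ G → Fintype.card V < 2 * c) :
    Nonempty (G ≃g cycleGraph (Fintype.card V)) := by
  classical
  obtain ⟨c, hc3, ⟨f⟩⟩ := exists_copy_cycleGraph_of_degree_eq_two hd
  have hclosed : ∀ x y, G.Adj x y → x ∈ Set.range f → y ∈ Set.range f := by
    rintro _ y hxy ⟨i, rfl⟩
    obtain ⟨j, -, rfl⟩ := f.exists_adj_of_degree_le (by rw [hd, degree_cycleGraph hc3]) hxy
    exact ⟨j, rfl⟩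
  have hsurj : Function.Surjective f := by
    by_contra hs
    obtain ⟨y, hy⟩ := not_forall.1 hs
    -- The complement of a closed cycle is again 2-regular, so it contains a second cycle; together
    -- they exceed the number of vertices.
    let s : Set V := (Set.range f)ᶜ
    have : Nonempty s := ⟨⟨y, hy⟩⟩
    have hds : ∀ v, (G.induce s).degree v = 2 := by
      intro v
      rw [← hd v.1]
      have := degree_induce_of_neighborSet_subset (G := G) (s := s) (v := v)
        fun w hw hwr ↦ v.2 (hclosed w v (G.adj_symm hw) hwr)
      convert this
    obtain ⟨c', hc3', ⟨g⟩⟩ := exists_copy_cycleGraph_of_degree_eq_two hds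
    have h₁ := hc c hc3 ⟨f⟩
    have h₂ := hc c' hc3' ⟨(Copy.induce G s).comp g⟩
    have h₃ : Fintype.card (Fin c ⊕ Fin c') ≤ Fintype.card V := by
      refine Fintype.card_le_of_injective (Sum.elim f fun j ↦ (g j).1) ?_
      refine Function.Injective.sumElim f.injective (Subtype.val_injective.comp g.injective) ?_
      intro i j h
      exact (g j).2 ⟨i, h⟩
    simp only [Fintype.card_sum, Fintype.card_fin] at h₃
    omega
  have hcV : c = Fintype.card V := by
    simpa using Fintype.card_of_bijective (f := f) ⟨f.injective, hsurj⟩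
  subst hcV
  obtain ⟨e⟩ := f.nonempty_iso_of_card_eq (by simp) (by
    have h₁ := G.sum_degrees_eq_twice_card_edges
    have h₂ := (cycleGraph (Fintype.card V)).sum_degrees_eq_twice_card_edges
    simp only [hd, degree_cycleGraph hc3, Finset.sum_const, Finset.card_univ, Fintype.card_fin,
      smul_eq_mul] at h₁ h₂
    omega)
  exact ⟨e.symm⟩

end Recognition

/-! ### Counting labelled copies of paths -/

section PathCounts

variable {V W : Type*}

lemma labelledCopyCount_eq_natCard [Fintype V] [Fintype W] (G : SimpleGraph V)
    (F : SimpleGraph W) : G.labelledCopyCount F = Nat.card (Copy F G) := by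
  classical
  rw [Nat.card_eq_fintype_card]
  unfold labelledCopyCount
  congr!

lemma labelledCopyCount_le_of_copy {U : Type*} [Fintype U] [Fintype V] [Fintype W]
    {G : SimpleGraph V} {H : SimpleGraph W} (f : Copy G H) (F : SimpleGraph U) :
    G.labelledCopyCount F ≤ H.labelledCopyCount F := by
  classical
  rw [labelledCopyCount_eq_natCard, labelledCopyCount_eq_natCard]
  refine Nat.card_le_card_of_injective (fun g ↦ f.comp g) fun g g' h ↦ Copy.ext fun a ↦ ?_
  have := DFunLike.congr_fun h a
  simp only [Copy.comp_apply] at this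
  exact f.injective this

/-- Labelled copies of the path with two vertices are darts. -/
def copyPathGraphTwoEquiv (G : SimpleGraph V) :
    Copy (pathGraph 2) G ≃ (Σ v, G.neighborSet v) where
  toFun f := ⟨f 0, f 1, f.toHom.map_adj (by simp [pathGraph_adj])⟩
  invFun p := ⟨⟨![p.1, p.2.1], by
      have := p.2.2
      rw [mem_neighborSet] at this
      intro a b h
      fin_cases a <;> fin_cases b <;> simp [pathGraph_adj, this, this.symm] at h ⊢⟩, by
      have := p.2.2
      rw [mem_neighborSet] at this
      intro a b h
      fin_cases a <;> fin_cases b <;> simp [this.ne, this.ne'] at h ⊢⟩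
  left_inv f := by
    ext a
    fin_cases a <;> rfl
  right_inv p := rfl

/-- Labelled copies of the path with three vertices are pairs of distinct neighbors of a vertex. -/
def copyPathGraphThreeEquiv (G : SimpleGraph V) :
    Copy (pathGraph 3) G ≃ (Σ v, {x : V × V // G.Adj v x.1 ∧ G.Adj v x.2 ∧ x.1 ≠ x.2}) where
  toFun f := ⟨f 1, (f 0, f 2), f.toHom.map_adj (by simp [pathGraph_adj]),
    f.toHom.map_adj (by simp [pathGraph_adj]), f.injective.ne (by decide)⟩
  invFun p := ⟨⟨![p.2.1.1, p.1, p.2.1.2], by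
      obtain ⟨h₁, h₂, -⟩ := p.2.2
      intro a b h
      fin_cases a <;> fin_cases b <;>
        simp [pathGraph_adj, h₁, h₂, h₁.symm, h₂.symm] at h ⊢⟩, by
      obtain ⟨h₁, h₂, h₃⟩ := p.2.2
      intro a b h
      fin_cases a <;> fin_cases b <;>
        simp [h₁.ne, h₂.ne, h₁.ne', h₂.ne', h₃, h₃.symm] at h ⊢⟩
  left_inv f := by
    ext a
    fin_cases a <;> rfl
  right_inv p := rfl

lemma labelledCopyCount_pathGraph_two [Fintype V] (G : SimpleGraph V) [DecidableRel G.Adj] :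
    G.labelledCopyCount (pathGraph 2) = ∑ v, G.degree v := by
  classical
  rw [labelledCopyCount_eq_natCard, Nat.card_congr (copyPathGraphTwoEquiv G),
    Nat.card_eq_fintype_card, Fintype.card_sigma]
  simp only [card_neighborSet_eq_degree]

lemma labelledCopyCount_pathGraph_three [Fintype V] (G : SimpleGraph V) [DecidableRel G.Adj] :
    G.labelledCopyCount (pathGraph 3) = ∑ v, (G.degree v * G.degree v - G.degree v) := by
  classical
  rw [labelledCopyCount_eq_natCard, Nat.card_congr (copyPathGraphThreeEquiv G),
    Nat.card_eq_fintype_card, Fintype.card_sigma]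
  refine Finset.sum_congr rfl fun v _ ↦ ?_
  rw [degree, ← Finset.offDiag_card]
  refine Fintype.card_of_subtype _ fun x ↦ ?_
  simp [Finset.mem_offDiag]

lemma cast_sum_mul_self_sub [Fintype V] (d : V → ℕ) :
    ((∑ v, (d v * d v - d v) : ℕ) : ℤ) = ∑ v, (d v : ℤ) ^ 2 - ∑ v, (d v : ℤ) := by
  rw [Nat.cast_sum, ← Finset.sum_sub_distrib]
  refine Finset.sum_congr rfl fun v _ ↦ ?_
  rw [Nat.cast_sub (Nat.le_mul_self _)]
  push_cast
  ring

/-- The `k`-deck with `3 ≤ k` determines the sum of any quadratic polynomial of the degrees. -/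
lemma sum_quadratic_degree_eq_of_kDeck_eq [Fintype V] [Fintype W] {G : SimpleGraph V}
    {H : SimpleGraph W} [DecidableRel G.Adj] [DecidableRel H.Adj] {k : ℕ}
    (h : G.kDeck k = H.kDeck k) (hVW : Fintype.card V = Fintype.card W) (hk : 3 ≤ k)
    (hkV : k ≤ Fintype.card V) (b c : ℤ) :
    ∑ v, ((G.degree v : ℤ) ^ 2 + b * G.degree v + c) =
      ∑ v, ((H.degree v : ℤ) ^ 2 + b * H.degree v + c) := by
  have h₂ := labelledCopyCount_eq_of_kDeck_eq h hVW hkV (pathGraph 2) (by simp; omega)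
  have h₃ := labelledCopyCount_eq_of_kDeck_eq h hVW hkV (pathGraph 3) (by simpa using hk)
  rw [labelledCopyCount_pathGraph_two, labelledCopyCount_pathGraph_two] at h₂
  rw [labelledCopyCount_pathGraph_three, labelledCopyCount_pathGraph_three] at h₃
  have h₃' := congrArg (Nat.cast (R := ℤ)) h₃
  rw [cast_sum_mul_self_sub, cast_sum_mul_self_sub] at h₃'
  have h₂' := congrArg (Nat.cast (R := ℤ)) h₂
  push_cast at h₂'
  simp only [Finset.sum_add_distrib, ← Finset.mul_sum, Finset.sum_const, Finset.card_univ, hVW]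
  rw [h₂'] at h₃' ⊢
  linarith

lemma card_edgeFinset_eq_of_kDeck_eq [Fintype V] [Fintype W] {G : SimpleGraph V}
    {H : SimpleGraph W} [Fintype G.edgeSet] [Fintype H.edgeSet] {k : ℕ}
    (h : G.kDeck k = H.kDeck k) (hVW : Fintype.card V = Fintype.card W) (hk : 2 ≤ k)
    (hkV : k ≤ Fintype.card V) : G.edgeFinset.card = H.edgeFinset.card := by
  classical
  have h₂ := labelledCopyCount_eq_of_kDeck_eq h hVW hkV (pathGraph 2) (by simpa using hk)
  rw [labelledCopyCount_pathGraph_two, labelledCopyCount_pathGraph_two,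
    sum_degrees_eq_twice_card_edges, sum_degrees_eq_twice_card_edges] at h₂
  have h₃ := Nat.eq_of_mul_eq_mul_left two_pos h₂
  convert h₃

/-- A nonbacktracking sequence with steps `±1` is monotone. -/
lemma eq_add_or_add_eq_of_step {g : ℕ → ℕ} {k : ℕ}
    (h₁ : ∀ t, t + 1 < k → g (t + 1) = g t + 1 ∨ g t = g (t + 1) + 1)
    (h₂ : ∀ t, t + 2 < k → g (t + 2) ≠ g t) :
    (∀ t < k, g t = g 0 + t) ∨ (∀ t < k, g t + t = g 0) := by
  by_cases hk : 1 < k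
  · rcases h₁ 0 hk with h | h
    · left
      have : ∀ t, t + 1 < k → g t = g 0 + t ∧ g (t + 1) = g 0 + (t + 1) := by
        intro t
        induction t with
        | zero => intro _; exact ⟨rfl, h⟩
        | succ t ih =>
          intro ht
          have := ih (by omega)
          have := h₁ (t + 1) ht
          have := h₂ t ht
          rw [show t + 2 = t + 1 + 1 from rfl] at this
          omega
      intro t ht
      rcases t with _ | t
      · rfl
      · exact (this t ht).2
    · right
      have : ∀ t, t + 1 < k → g t + t = g 0 ∧ g (t + 1) + (t + 1) = g 0 := by
        intro t
        induction t with
        | zero => intro _; exact ⟨rfl, h.symm⟩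
        | succ t ih =>
          intro ht
          have := ih (by omega)
          have := h₁ (t + 1) ht
          have := h₂ t ht
          rw [show t + 2 = t + 1 + 1 from rfl] at this
          omega
      intro t ht
      rcases t with _ | t
      · rfl
      · exact (this t ht).2
  · left
    intro t ht
    rw [show t = 0 by omega, Nat.add_zero]

/-- Adjacency makes each step `±1`, and injectivity forbids turning back. -/
lemma Copy.pathGraph_val {k n : ℕ} (f : Copy (pathGraph k) (pathGraph n)) (hk : 0 < k) :
    (∀ t, (f t).1 = (f ⟨0, hk⟩).1 + t.1) ∨ (∀ t, (f t).1 + t.1 = (f ⟨0, hk⟩).1) := by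
  let g : ℕ → ℕ := fun t ↦ if h : t < k then (f ⟨t, h⟩).1 else 0
  have hg : ∀ t (h : t < k), g t = (f ⟨t, h⟩).1 := fun t h ↦ dif_pos h
  have := eq_add_or_add_eq_of_step (g := g) (k := k) (fun t ht ↦ ?_) fun t ht ↦ ?_
  · rw [hg 0 hk] at this
    refine this.imp (fun h t ↦ ?_) (fun h t ↦ ?_)
    · rw [← h t t.2, hg t t.2]
    · rw [← h t t.2, hg t t.2]
  · rw [hg _ ht, hg t (by omega)]
    have hadj : (pathGraph k).Adj ⟨t, by omega⟩ ⟨t + 1, ht⟩ := by simp [pathGraph_adj]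
    have := pathGraph_adj.1 (f.toHom.map_adj hadj)
    simp only [Copy.toHom_apply] at this
    omega
  · rw [hg _ ht, hg t (by omega)]
    intro h
    have := f.injective (Fin.ext h)
    simp at this

lemma labelledCopyCount_pathGraph_pathGraph_le {k n : ℕ} (hk : 0 < k) (hkn : k ≤ n) :
    (pathGraph n).labelledCopyCount (pathGraph k) ≤ 2 * (n - k + 1) := by
  classical
  rw [labelledCopyCount_eq_natCard]
  -- A copy is determined by its direction and its lowest position, which is the smaller of its two
  -- ends.
  let Φ : Copy (pathGraph k) (pathGraph n) → Bool × Fin (n - k + 1) := fun f ↦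
    (decide (∀ t, (f t).1 = (f ⟨0, hk⟩).1 + t.1),
      ⟨min (f ⟨0, hk⟩).1 (f ⟨k - 1, by omega⟩).1, by
        have h₁ := (f ⟨0, hk⟩).2
        have h₂ := (f ⟨k - 1, by omega⟩).2
        rcases f.pathGraph_val hk with h | h
        · have := h ⟨k - 1, by omega⟩
          dsimp only at this
          omega
        · have := h ⟨k - 1, by omega⟩
          dsimp only at this
          omega⟩)
  have hΦ : Function.Injective Φ := by
    intro f g hfg
    have h₁ := congrArg Prod.fst hfg
    have h₂ := congrArg (fun x ↦ x.2.1) hfg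
    simp only [Φ, decide_eq_decide] at h₁ h₂
    ext t
    by_cases hf : ∀ t, (f t).1 = (f ⟨0, hk⟩).1 + t.1
    · have hg := h₁.1 hf
      have e₁ := hf ⟨k - 1, by omega⟩
      have e₂ := hg ⟨k - 1, by omega⟩
      dsimp only at e₁ e₂
      rw [hf t, hg t]
      omega
    · have hg := mt h₁.2 hf
      have hf' := (f.pathGraph_val hk).resolve_left hf
      have hg' := (g.pathGraph_val hk).resolve_left hg
      have e₁ := hf' ⟨k - 1, by omega⟩
      have e₂ := hg' ⟨k - 1, by omega⟩
      dsimp only at e₁ e₂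
      have := hf' t
      have := hg' t
      omega
  have := Nat.card_le_card_of_injective Φ hΦ
  simpa using this

/-- The copy of a path in a cycle that starts at `i` and runs forwards or backwards. -/
def pathCopyCycleGraph {k m : ℕ} (hk : k ≤ m + 3) (b : Bool) (i : Fin (m + 3)) :
    Copy (pathGraph k) (cycleGraph (m + 3)) where
  toHom :=
    { toFun := fun t ↦ if b then i + t.castLE hk else i - t.castLE hk
      map_rel' := by
        intro s t h
        have hst : (cycleGraph (m + 3)).Adj (s.castLE hk) (t.castLE hk) :=
          pathGraph_le_cycleGraph (by rwa [pathGraph_adj] at h ⊢)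
        rw [cycleGraph_adj] at hst ⊢
        cases b
        · simpa [or_comm] using hst
        · simpa using hst }
  injective' := by
    intro s t h
    refine Fin.castLE_injective hk ?_
    cases b
    · simpa using h
    · simpa using h

/-- Each start and direction gives a copy. The first two vertices tell them apart, because `i + 1 ≠
i - 1` in a cycle of length at least three. -/
lemma two_mul_le_labelledCopyCount_cycleGraph {k c : ℕ} (hk : 2 ≤ k) (hc : 3 ≤ c) (hkc : k ≤ c) :
    2 * c ≤ (cycleGraph c).labelledCopyCount (pathGraph k) := by
  classical
  obtain ⟨m, rfl⟩ := Nat.exists_eq_add_of_le' hc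
  rw [labelledCopyCount_eq_natCard]
  have hinj : Function.Injective fun x : Bool × Fin (m + 3) ↦ pathCopyCycleGraph hkc x.1 x.2 := by
    rintro ⟨b, i⟩ ⟨b', i'⟩ h
    have h₀ := DFunLike.congr_fun h ⟨0, by omega⟩
    have h₁ := DFunLike.congr_fun h ⟨1, by omega⟩
    change (if b then _ else _) = (if b' then _ else _) at h₀ h₁
    have e₀ : (⟨0, by omega⟩ : Fin k).castLE hkc = 0 := rfl
    have e₁ : (⟨1, by omega⟩ : Fin k).castLE hkc = 1 := rfl
    rw [e₀] at h₀
    rw [e₁] at h₁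
    have hi : i = i' := by cases b <;> cases b' <;> simpa using h₀
    subst hi
    have hne : i + 1 ≠ i - 1 := by
      intro h
      have h2 : (1 : Fin (m + 3)) + 1 = 0 := by
        have := congrArg (· - i + 1) h
        simpa using this
      have := congrArg Fin.val h2
      simp only [Fin.val_add, Fin.val_one, Fin.val_zero] at this
      rw [Nat.mod_eq_of_lt (by omega)] at this
      omega
    cases b <;> cases b' <;> simp_all
  have := Nat.card_le_card_of_injective _ hinj
  simpa using this

end PathCounts

/-! ### Reconstruction -/

theorem isDeckReconstructible_pathGraph {n : ℕ} (hn : 4 ≤ n) :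
    IsDeckReconstructible (n / 2 + 1) (pathGraph n) := by
  classical
  intro m H h
  obtain rfl : m = n := by
    simpa using card_eq_of_kDeck_eq (by omega) (by rw [Fintype.card_fin]; omega) h
  have : Nonempty (Fin m) := ⟨⟨0, by omega⟩⟩
  have hkm : m / 2 + 1 ≤ Fintype.card (Fin m) := by rw [Fintype.card_fin]; omega
  -- The polynomial is `(d - 1) * (d - 2)`: zero on the degrees of a path and nonnegative at every
  -- natural number.
  have hsum := sum_quadratic_degree_eq_of_kDeck_eq h rfl (by omega) hkm (-3) 2
  rw [Finset.sum_eq_zero (s := Finset.univ)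
    (f := fun v ↦ (((pathGraph m).degree v : ℤ) ^ 2 + -3 * (pathGraph m).degree v + 2))] at hsum
  swap
  · intro v _
    have h₁ := degree_pathGraph_le_two v
    have h₂ := degree_pathGraph_pos (by omega) v
    obtain h | h : (pathGraph m).degree v = 1 ∨ (pathGraph m).degree v = 2 := by omega
    all_goals rw [h]; norm_num
  have hdeg : ∀ v, H.degree v ≤ 2 := by
    rw [Finset.sum_eq_zero_iff_of_nonneg] at hsum
    · intro v
      have := hsum v (Finset.mem_univ v)
      have : (H.degree v : ℤ) ≤ 2 := by nlinarith
      exact_mod_cast this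
    · intro v _
      obtain h | h | h : H.degree v = 0 ∨ H.degree v = 1 ∨ 2 ≤ H.degree v := by omega
      · rw [h]; norm_num
      · rw [h]; norm_num
      · have : (2 : ℤ) ≤ H.degree v := by exact_mod_cast h
        nlinarith
  have hac : H.IsAcyclic := by
    rw [isAcyclic_iff_free_cycleGraph]
    rintro c hc ⟨f⟩
    by_cases hck : c ≤ m / 2 + 1
    · have h₁ := labelledCopyCount_eq_of_kDeck_eq h rfl hkm (cycleGraph c) (by simpa using hck)
      rw [labelledCopyCount_eq_zero.2 (isAcyclic_iff_free_cycleGraph.1 (isAcyclic_pathGraph m) c hc),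
        labelledCopyCount_eq_zero] at h₁
      exact h₁ ⟨f⟩
    -- With `k = m / 2 + 1`, a longer cycle yields at least `2 * c` copies of `P_k`, above the `2 *
    -- (m - k + 1)` that a path allows.
    · have h₁ := labelledCopyCount_eq_of_kDeck_eq h rfl hkm (pathGraph (m / 2 + 1)) (by simp)
      have h₂ := labelledCopyCount_pathGraph_pathGraph_le (k := m / 2 + 1) (n := m) (by omega)
        (by omega)
      have h₃ := two_mul_le_labelledCopyCount_cycleGraph (k := m / 2 + 1) (c := c) (by omega) hc
        (by omega)
      have h₄ := labelledCopyCount_le_of_copy f (pathGraph (m / 2 + 1))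
      omega
  have hE := card_edgeFinset_eq_of_kDeck_eq h rfl (by omega) hkm
  have hP := (isTree_pathGraph (n := m) (by omega)).card_edgeFinset
  have hT := hac.isTree_of_card_edgeFinset (by rw [hE, hP])
  have hiso := hT.nonempty_iso_pathGraph hdeg
  rwa [Fintype.card_fin] at hiso

theorem isDeckReconstructible_cycleGraph {n : ℕ} (hn : 6 ≤ n) :
    IsDeckReconstructible (n / 2) (cycleGraph n) := by
  classical
  intro m H h
  obtain rfl : m = n := by
    simpa using card_eq_of_kDeck_eq (by omega) (by rw [Fintype.card_fin]; omega) h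
  have : Nonempty (Fin m) := ⟨⟨0, by omega⟩⟩
  have hkm : m / 2 ≤ Fintype.card (Fin m) := by rw [Fintype.card_fin]; omega
  -- The polynomial is `(d - 2) ^ 2`; counting `P_3` needs `3 ≤ m / 2`, hence `6 ≤ m`.
  have hsum := sum_quadratic_degree_eq_of_kDeck_eq h rfl (by omega) hkm (-4) 4
  simp only [degree_cycleGraph (show 3 ≤ m by omega)] at hsum
  norm_num at hsum
  have hsq : ∀ v, (H.degree v : ℤ) ^ 2 + -(4 * H.degree v) + 4 = ((H.degree v : ℤ) - 2) ^ 2 :=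
    fun v ↦ by ring
  have hdeg : ∀ v, H.degree v = 2 := by
    simp only [hsq] at hsum
    rw [Finset.sum_eq_zero_iff_of_nonneg fun v _ ↦ sq_nonneg _] at hsum
    intro v
    have := pow_eq_zero_iff two_ne_zero |>.1 (hsum v (Finset.mem_univ v))
    omega
  have hcyc : ∀ c ≥ 3, cycleGraph c ⊑ H → Fintype.card (Fin m) < 2 * c := by
    intro c hc hcH
    by_contra! hle
    rw [Fintype.card_fin] at hle
    have h₁ := labelledCopyCount_eq_of_kDeck_eq h rfl hkm (cycleGraph c) (by simp; omega)
    rw [← labelledCopyCount_pos, h₁, labelledCopyCount_pos] at hcH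
    obtain ⟨f⟩ := hcH
    -- A cycle inside the connected graph `C_m` is closed under adjacency, so it is everything,
    -- against `2 * c ≤ m`.
    have hsurj : Function.Surjective f := by
      intro y
      by_contra hy
      refine not_connected_of_closed (G := cycleGraph m) (s := Set.range f)
        (x := f ⟨0, by omega⟩) (y := y) ?_ ⟨_, rfl⟩ hy (connected_cycleGraph (by omega))
      rintro _ z hz ⟨i, rfl⟩
      obtain ⟨j, -, rfl⟩ := f.exists_adj_of_degree_le
        (by rw [degree_cycleGraph (by omega), degree_cycleGraph hc]) hz
      exact ⟨j, rfl⟩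
    have := Fintype.card_le_of_surjective f hsurj
    simp only [Fintype.card_fin] at this
    omega
  have hiso := nonempty_iso_cycleGraph_of_degree_eq_two hdeg hcyc
  rwa [Fintype.card_fin] at hiso

end SimpleGraph

theorem corollary1p8 :
    -- connectedness of arbitrary `n`-vertex graphs
    (∀ n : ℕ, 3 ≤ n →
      ∃ k : ℕ, IsLeast {j : ℕ | SimpleGraph.DeckDeterminesConnected n (fun _ => True) j} k ∧
        n / 2 + 1 ≤ k) ∧
    -- connectedness when the maximum degree is known to be at most two
    (∀ n : ℕ, 3 ≤ n →
      ∃ k : ℕ,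
        IsLeast {j : ℕ | SimpleGraph.DeckDeterminesConnected n (fun G => G.maxDeg ≤ 2) j} k ∧
        n / 2 + 1 ≤ k) ∧
    -- connectedness when the maximum degree is known to be exactly two
    (∀ n : ℕ, 4 ≤ n →
      ∃ k : ℕ,
        IsLeast {j : ℕ | SimpleGraph.DeckDeterminesConnected n (fun G => G.maxDeg = 2) j} k ∧
        n / 2 + 1 ≤ k) ∧
    -- paths and cycles
    (∀ n : ℕ, 6 ≤ n →
      IsLeast {k : ℕ | SimpleGraph.IsDeckReconstructible k (SimpleGraph.pathGraph n)}
        (n / 2 + 1) ∧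
      IsLeast {k : ℕ | SimpleGraph.IsDeckReconstructible k (SimpleGraph.cycleGraph n)}
        (n / 2)) := by
  refine ⟨fun n hn ↦ ?_, fun n hn ↦ ?_, fun n hn ↦ ?_, fun n hn ↦ ⟨⟨?_, fun k hk ↦ ?_⟩,
    ⟨?_, fun k hk ↦ ?_⟩⟩⟩
  · refine SimpleGraph.exists_isLeast_deckDeterminesConnected fun k hk ↦ ?_
    obtain rfl | hn4 := hn.eq_or_lt
    · exact SimpleGraph.not_deckDeterminesConnected_three (by omega) fun _ _ ↦ trivial
    · exact SimpleGraph.not_deckDeterminesConnected hn4 (by omega) fun _ _ ↦ trivial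
  · refine SimpleGraph.exists_isLeast_deckDeterminesConnected fun k hk ↦ ?_
    obtain rfl | hn4 := hn.eq_or_lt
    · exact SimpleGraph.not_deckDeterminesConnected_three (by omega) fun _ h ↦ h
    · exact SimpleGraph.not_deckDeterminesConnected hn4 (by omega) fun _ h ↦ h.le
  · exact SimpleGraph.exists_isLeast_deckDeterminesConnected fun k hk ↦
      SimpleGraph.not_deckDeterminesConnected hn (by omega) fun _ h ↦ h
  · exact SimpleGraph.isDeckReconstructible_pathGraph (by omega)
  · by_contra hlt
    exact SimpleGraph.not_isDeckReconstructible_pathGraph (by omega) (by omega) hk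
  · exact SimpleGraph.isDeckReconstructible_cycleGraph hn
  · by_contra hlt
    exact SimpleGraph.not_isDeckReconstructible_cycleGraph (by omega) (by omega) hk
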